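/- Let $W=P_{Y|X}$ be a channel (Markov kernel) from a nonempty measurable space $\mathcal X$ to a measurable space $\Omega$, and for $n\ge 1$ let $W^{\otimes n}$ be its memoryless extension, $W_{x^n}:=W_{x_1}\otimes\cdots\otimes W_{x_n}$. For real $\alpha\ge 1$ and $h\ge 0$ put $$c_\alpha(h):=\inf_{t>0}\left\{(\alpha-1)t+\frac{h}{1-e^{-t}}\right\}.$$ All logarithms are natural. (1) Let $Q_Y$ be a probability measure on $\Omega$ with $W_x\ll Q_Y$ for all $x\in\mathcal X$ and $$\alpha:=\sup_{x\in\mathcal X}\left\|\frac{dW_x}{dQ_Y}\right\|_{L^\infty(Q_Y)}<\infty .$$ Then $\alpha\ge 1$. Moreover, let $n\ge 1$ and let $I-Z^n-X^n-Y^n$ be a Markov chain of random variables, where $I$ takes values in a countable discrete set, $X^n$ in $\mathcal X^n$, $Y^n$ and $Z^n$ in $\Omega^n$, and $P_{Y^n|X^n}=P_{Z^n|X^n}=W^{\otimes n}$. If the conditional Shannon entropy $H(I|X^n)$ is finite, then so is $H(I|Y^n)$, and with $h:=\frac1n H(I|X^n)$, $$\frac1n H(I|Y^n)\le c_\alpha(h).$$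 (2) For $\alpha>1$ and $h>0$ the infimum defining $c_\alpha(h)$ is a minimum, and for $\alpha>1$ and $h\ge 0$ $$c_\alpha(h)=(\alpha-1)\left[\ln\left(1+\frac{h}{2(\alpha-1)}+\sqrt{\frac{h}{\alpha-1}+\frac{h^2}{4(\alpha-1)^2}}\right)+\frac{h}{2(\alpha-1)}+\sqrt{\frac{h}{\alpha-1}+\frac{h^2}{4(\alpha-1)^2}}\,\right].$$ For $\alpha=1$ and $h\ge 0$, $c_1(h)=h$. (3) Suppose $\Omega$ is countable and discrete. If $\mathcal X$ or $\Omega$ is finite, then $\sum_{y\in\Omega}\sup_{x\in\mathcal X}W_x(y)<\infty$. Whenever this sum is finite, there is a probability measure $Q_Y$ on $\Omega$ with $W_x\ll Q_Y$ for all $x$ and $$\sup_{x\in\mathcal X}\left\|\frac{dW_x}{dQ_Y}\right\|_{L^\infty(Q_Y)}=\sum_{y\in\Omega}\sup_{x\in\mathcal X}W_x(y).$$ -/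

import Mathlib

open MeasureTheory ProbabilityTheory Set
open scoped ENNReal

noncomputable section

namespace RelayChannel

/-- Measurability of `xⁿ ↦ W_{x₁} ⊗ ⋯ ⊗ W_{xₙ}`. -/
lemma measurable_pi_kernel {𝓧 Ω : Type*} [MeasurableSpace 𝓧] [MeasurableSpace Ω]
    (W : Kernel 𝓧 Ω) [IsMarkovKernel W] (n : ℕ) :
    Measurable (fun x : Fin n → 𝓧 => Measure.pi (fun i => W (x i))) := by
  refine Measurable.measure_of_isPiSystem_of_isProbabilityMeasure
    (S := Set.pi univ '' Set.pi univ fun _ : Fin n => {s : Set Ω | MeasurableSet s})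
    generateFrom_pi.symm isPiSystem_pi ?_
  rintro _ ⟨s, hs, rfl⟩
  simp only [Measure.pi_pi]
  refine Finset.measurable_prod _ fun i _ => ?_
  exact (W.measurable_coe (hs i (mem_univ i))).comp (measurable_pi_apply i)

/-- The memoryless extension `W^{⊗n}`: the input `xⁿ` is sent to `W_{x₁} ⊗ ⋯ ⊗ W_{xₙ}`. -/
def memoryless {𝓧 Ω : Type*} [MeasurableSpace 𝓧] [MeasurableSpace Ω]
    (W : Kernel 𝓧 Ω) [IsMarkovKernel W] (n : ℕ) : Kernel (Fin n → 𝓧) (Fin n → Ω) where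
  toFun x := Measure.pi (fun i => W (x i))
  measurable' := measurable_pi_kernel W n

instance {𝓧 Ω : Type*} [MeasurableSpace 𝓧] [MeasurableSpace Ω]
    (W : Kernel 𝓧 Ω) [IsMarkovKernel W] (n : ℕ) : IsMarkovKernel (memoryless W n) :=
  ⟨fun x => by
    change IsProbabilityMeasure (Measure.pi (fun i => W (x i)))
    infer_instance⟩

/-- `P_{B|A} = κ`: the joint law of `(A, B)` is the law of `A` followed by the channel `κ`. -/
def HasCondLaw {S 𝓐 𝓑 : Type*} [MeasurableSpace S] [MeasurableSpace 𝓐] [MeasurableSpace 𝓑]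
    (P : Measure S) (B : S → 𝓑) (A : S → 𝓐) (κ : Kernel 𝓐 𝓑) : Prop :=
  P.map (fun ω => (A ω, B ω)) = (P.map A) ⊗ₘ κ

/-- The Markov chain `A – B – C`: the conditional law of `A` given `(B, C)` is a Markov kernel
that depends on `B` only. -/
def IsMarkovTriple {S 𝓐 𝓑 𝓒 : Type*} [MeasurableSpace S] [MeasurableSpace 𝓐]
    [MeasurableSpace 𝓑] [MeasurableSpace 𝓒]
    (P : Measure S) (A : S → 𝓐) (B : S → 𝓑) (C : S → 𝓒) : Prop :=
  ∃ κ : Kernel 𝓑 𝓐, IsMarkovKernel κ ∧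
    HasCondLaw P A (fun ω => (B ω, C ω)) (κ.prodMkRight 𝓒)

/-- The Markov chain `A – B – C – D`, that is, `A – B – (C, D)` and `B – C – D`. -/
def IsMarkovQuadruple {S 𝓐 𝓑 𝓒 𝓓 : Type*} [MeasurableSpace S] [MeasurableSpace 𝓐]
    [MeasurableSpace 𝓑] [MeasurableSpace 𝓒] [MeasurableSpace 𝓓]
    (P : Measure S) (A : S → 𝓐) (B : S → 𝓑) (C : S → 𝓒) (D : S → 𝓓) : Prop :=
  IsMarkovTriple P A B (fun ω => (C ω, D ω)) ∧ IsMarkovTriple P B C D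

/-- Conditional Shannon entropy (in nats) `H(I|U) = 𝔼[∑ᵢ -p(i|U) ln p(i|U)]` of a discrete random
variable `I` given an arbitrary random variable `U`, where `p(·|u)` is the conditional law. -/
def condEntropy {S ι 𝓤 : Type*} [MeasurableSpace S] [MeasurableSpace ι] [MeasurableSpace 𝓤]
    [Countable ι] [DiscreteMeasurableSpace ι] [Nonempty ι]
    (P : Measure S) [IsFiniteMeasure P] (I : S → ι) (U : S → 𝓤) : ℝ≥0∞ :=
  ∫⁻ u, ∑' i : ι, ENNReal.ofReal (Real.negMulLog ((condDistrib I U P u).real {i})) ∂(P.map U)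

/-- `sup_x ‖dW_x/dQ‖_∞`, with the essential supremum taken with respect to `Q`
(used when every `W_x` is absolutely continuous with respect to `Q`). -/
def densityBound {𝓧 Ω : Type*} [MeasurableSpace 𝓧] [MeasurableSpace Ω]
    (W : Kernel 𝓧 Ω) (Q : Measure Ω) : ℝ≥0∞ :=
  ⨆ x, essSup ((W x).rnDeriv Q) Q

/-- The values `(α - 1) t + h / (1 - e^{-t})`, `t > 0`. -/
def boundValues (α h : ℝ) : Set ℝ :=
  (fun t : ℝ => (α - 1) * t + 1 / (1 - Real.exp (-t)) * h) '' Ioi 0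

/-- `c_α(h)`, the infimum over `t > 0` of `(α - 1) t + h / (1 - e^{-t})`. -/
def cBound (α h : ℝ) : ℝ := sInf (boundValues α h)

/-- The closed form of `c_α(h)` for `α > 1`. -/
def cClosed (α h : ℝ) : ℝ :=
  (α - 1) *
    (Real.log (1 + h / (2 * (α - 1)) + √(h / (α - 1) + h ^ 2 / (4 * (α - 1) ^ 2)))
      + h / (2 * (α - 1)) + √(h / (α - 1) + h ^ 2 / (4 * (α - 1) ^ 2)))

end RelayChannel

end

/-!
Any channel `η` estimating `I` from `Yⁿ` gives `H(I|Yⁿ) ≤ 𝔼[-ln η(I|Yⁿ)]` by Gibbs' inequality. By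
the Markov property the conditional law of `I` given `(Xⁿ, Yⁿ)` is `ρ(·|Xⁿ)`, where `ρ = κ ∘ W^{⊗n}`
and `κ` is the conditional law of `I` given `Zⁿ`. Given `Xⁿ = x`, the copies `Yⁿ` and `Zⁿ` have the
same law `W_x`, so one estimates `I` by perturbing `Yⁿ` and then applying `κ`.

If each coordinate `y_i` is resampled from `W_{x_i}` with probability `p`, the resulting operator is
reverse hypercontractive from `L^p` to `L^0`: this is a one-dimensional inequality, which tensorizes
by Minkowski's inequality. Hence `-ln ρ(i|x)` grows at most by the factor `1/p`. This perturbation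
depends on the unknown `x`, but as `W_x ≤ α Q` it is bounded by `1 + (α - 1) p` times resampling
from `Q` with probability `α p / (1 + (α - 1) p)`, which `η` can use at the additional cost
`n ln(1 + (α - 1) p)`. Put `p = 1 - e^{-t}`, so that `ln(1 + (α - 1) p) ≤ (α - 1) t`.
-/

namespace RelayChannel

/-- `-ln a` for `a ≤ 1`, as a value in `[0, ∞]`. It is truncated to `0` for `a > 1`. -/
noncomputable def negLog (a : ℝ≥0∞) : ℝ≥0∞ := (-ENNReal.log a).toENNReal

@[simp] lemma negLog_zero : negLog 0 = ∞ := by simp [negLog]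

lemma negLog_ofReal {x : ℝ} (hx : 0 < x) :
    negLog (ENNReal.ofReal x) = ENNReal.ofReal (-Real.log x) := by
  rw [negLog, ENNReal.log_ofReal_of_pos hx, ← EReal.coe_neg, EReal.toENNReal_of_ne_top (by simp),
    EReal.toReal_coe]

lemma antitone_negLog : Antitone negLog := fun _ _ h =>
  EReal.toENNReal_le_toENNReal (EReal.neg_le_neg_iff.2 (ENNReal.log_monotone h))

@[fun_prop] lemma measurable_negLog : Measurable negLog :=
  measurable_ereal_toENNReal.comp ENNReal.measurable_log.neg

lemma negLog_rpow {r : ℝ} (hr : 0 ≤ r) (a : ℝ≥0∞) :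
    negLog (a ^ r) = ENNReal.ofReal r * negLog a := by
  rw [negLog, ENNReal.log_rpow, ← mul_neg, EReal.toENNReal_mul (by exact_mod_cast hr),
    EReal.toENNReal_of_ne_top (EReal.coe_ne_top r), EReal.toReal_coe, negLog]

lemma ofReal_inv_mul_negLog_rpow {p : ℝ} (hp : 0 < p) (a : ℝ≥0∞) :
    ENNReal.ofReal p⁻¹ * negLog (a ^ p) = negLog a := by
  rw [negLog_rpow hp.le, ← mul_assoc, ← ENNReal.ofReal_mul (by positivity),
    inv_mul_cancel₀ hp.ne', ENNReal.ofReal_one, one_mul]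

lemma exists_pos_eq_ofReal {a : ℝ≥0∞} (h0 : a ≠ 0) (htop : a ≠ ∞) :
    ∃ x : ℝ, 0 < x ∧ a = ENNReal.ofReal x :=
  ⟨a.toReal, ENNReal.toReal_pos h0 htop, (ENNReal.ofReal_toReal htop).symm⟩

lemma negLog_le_log_add_of_le_mul {a b : ℝ≥0∞} {c : ℝ} (hc : 0 < c)
    (h : a ≤ ENNReal.ofReal c * b) :
    negLog b ≤ ENNReal.ofReal (Real.log c) + negLog a := by
  refine le_trans ?_ (add_le_add_right (antitone_negLog h) _)
  rcases eq_or_ne b ∞ with rfl | hbtop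
  · simp [negLog]
  rcases eq_or_ne b 0 with rfl | hb0
  · simp
  obtain ⟨y, hy, rfl⟩ := exists_pos_eq_ofReal hb0 hbtop
  rw [← ENNReal.ofReal_mul hc.le, negLog_ofReal hy, negLog_ofReal (mul_pos hc hy),
    Real.log_mul hc.ne' hy.ne']
  refine le_trans (ENNReal.ofReal_le_ofReal ?_) ENNReal.ofReal_add_le
  linarith

lemma mul_negLog_self (a : ℝ≥0∞) :
    a * negLog a = ENNReal.ofReal (Real.negMulLog a.toReal) := by
  rcases eq_or_ne a 0 with rfl | h0
  · simp
  rcases eq_or_ne a ∞ with rfl | htop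
  · simp [negLog]
  obtain ⟨x, hx, rfl⟩ := exists_pos_eq_ofReal h0 htop
  rw [negLog_ofReal hx, ← ENNReal.ofReal_mul hx.le, ENNReal.toReal_ofReal hx.le,
    Real.negMulLog, mul_neg, neg_mul]

lemma negLog_add_one_le {a b : ℝ≥0∞} (h0 : a ≠ 0) (ha : a ≤ 1) (hb : b ≤ 1) :
    negLog a + 1 ≤ negLog b + b / a := by
  rcases eq_or_ne b 0 with rfl | hb0
  · simp
  obtain ⟨x, hx, rfl⟩ := exists_pos_eq_ofReal h0 (ha.trans_lt ENNReal.one_lt_top).ne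
  obtain ⟨y, hy, rfl⟩ := exists_pos_eq_ofReal hb0 (hb.trans_lt ENNReal.one_lt_top).ne
  have hlogx : 0 ≤ -Real.log x := neg_nonneg.2 (Real.log_nonpos hx.le (by simpa using ha))
  have hlogy : 0 ≤ -Real.log y := neg_nonneg.2 (Real.log_nonpos hy.le (by simpa using hb))
  rw [negLog_ofReal hx, negLog_ofReal hy, ← ENNReal.ofReal_div_of_pos hx, ← ENNReal.ofReal_one,
    ← ENNReal.ofReal_add hlogx zero_le_one, ← ENNReal.ofReal_add hlogy (by positivity)]
  apply ENNReal.ofReal_le_ofReal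
  have hlog := Real.log_le_sub_one_of_pos (div_pos hy hx)
  rw [Real.log_div hy.ne' hx.ne'] at hlog
  linarith

lemma mul_negLog_self_add_le {a b : ℝ≥0∞} (ha : a ≤ 1) (hb : b ≤ 1) :
    a * negLog a + a ≤ a * negLog b + b := by
  rcases eq_or_ne a 0 with rfl | h0
  · simp
  calc a * negLog a + a = a * (negLog a + 1) := by ring
    _ ≤ a * (negLog b + b / a) := mul_le_mul_right (negLog_add_one_le h0 ha hb) a
    _ = a * negLog b + b := by
      rw [mul_add, ENNReal.mul_div_cancel h0 (ha.trans_lt ENNReal.one_lt_top).ne]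

lemma tsum_mul_negLog_self_le {ι : Type*} {a b : ι → ℝ≥0∞} (ha : ∑' i, a i = 1)
    (hb : ∑' i, b i ≤ 1) : ∑' i, a i * negLog (a i) ≤ ∑' i, a i * negLog (b i) := by
  refine (ENNReal.add_le_add_iff_right ENNReal.one_ne_top).1 ?_
  calc (∑' i, a i * negLog (a i)) + 1 = ∑' i, (a i * negLog (a i) + a i) := by
        rw [ENNReal.tsum_add, ha]
    _ ≤ ∑' i, (a i * negLog (b i) + b i) := ENNReal.tsum_le_tsum fun i =>
        mul_negLog_self_add_le ((ENNReal.le_tsum i).trans ha.le) ((ENNReal.le_tsum i).trans hb)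
    _ ≤ (∑' i, a i * negLog (b i)) + 1 := by
        rw [ENNReal.tsum_add]
        gcongr

section OneDimensional

variable {p : ℝ}

lemma hasDerivAt_logGap {u : ℝ} (hp : 0 < p) (hp1 : p < 1) (hu : 0 < u) :
    HasDerivAt (fun u : ℝ => Real.log ((1 - p) * u + p) - ((u ^ p - 1) / p - p * (u - 1)))
      ((1 - p) / ((1 - p) * u + p) - (u ^ (p - 1) - p)) u := by
  have hv : 0 < (1 - p) * u + p := add_pos (mul_pos (sub_pos.2 hp1) hu) hp
  have hlin : HasDerivAt (fun u : ℝ => (1 - p) * u + p) (1 - p) u := by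
    simpa using ((hasDerivAt_id u).const_mul (1 - p)).add_const p
  have hpow : HasDerivAt (fun u : ℝ => (u ^ p - 1) / p) (u ^ (p - 1)) u := by
    have := ((Real.hasDerivAt_rpow_const (p := p) (Or.inl hu.ne')).sub_const 1).div_const p
    rwa [mul_div_cancel_left₀ _ hp.ne'] at this
  have hlin' : HasDerivAt (fun u : ℝ => p * (u - 1)) p u := by
    simpa using ((hasDerivAt_id u).sub_const 1).const_mul p
  exact (hlin.log hv.ne').sub (hpow.sub hlin')

lemma div_add_le_rpow_sub_one {u : ℝ} (hp : 0 < p) (hp1 : p < 1) (hu : 0 < u) (hu1 : u ≤ 1) :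
    (1 - p) / ((1 - p) * u + p) + p ≤ u ^ (p - 1) := by
  have hbernoulli : u ^ (1 - p) ≤ (1 - p) * u + p := by
    have := rpow_one_add_le_one_add_mul_self (s := u - 1) (by linarith) (p := 1 - p)
      (by linarith) (by linarith)
    rw [add_sub_cancel] at this
    linarith
  have hpos : 0 < u ^ (1 - p) := Real.rpow_pos_of_pos hu _
  have hle : u ^ (1 - p) ≤ 1 := Real.rpow_le_one hu.le hu1 (by linarith)
  calc (1 - p) / ((1 - p) * u + p) + p ≤ (1 - p) / u ^ (1 - p) + p / u ^ (1 - p) := by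
        refine add_le_add (div_le_div_of_nonneg_left (by linarith) hpos hbernoulli) ?_
        exact le_div_self hp.le hpos hle
    _ = u ^ (p - 1) := by
        rw [← add_div, sub_add_cancel, one_div, ← Real.rpow_neg hu.le, neg_sub]

lemma rpow_sub_one_le_div_add {u : ℝ} (hp : 0 < p) (hp1 : p < 1) (hu : 1 ≤ u) :
    u ^ (p - 1) ≤ (1 - p) / ((1 - p) * u + p) + p := by
  have hu0 : 0 < u := zero_lt_one.trans_le hu
  have hbernoulli : u ^ (p - 1) ≤ 1 + (1 - p) * (u⁻¹ - 1) := by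
    have := rpow_one_add_le_one_add_mul_self (s := u⁻¹ - 1) (by linarith [inv_pos.2 hu0])
      (p := 1 - p) (by linarith) (by linarith)
    rwa [add_sub_cancel, Real.inv_rpow hu0.le, ← Real.rpow_neg hu0.le, neg_sub] at this
  have hv : (1 - p) * u + p ≤ u := by nlinarith
  have hvpos : 0 < (1 - p) * u + p := add_pos (mul_pos (sub_pos.2 hp1) hu0) hp
  calc u ^ (p - 1) ≤ (1 - p) / u + p := by rw [div_eq_mul_inv]; linarith
    _ ≤ (1 - p) / ((1 - p) * u + p) + p :=
      add_le_add_left (div_le_div_of_nonneg_left (by linarith) hvpos hv) p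

lemma rpow_sub_one_div_sub_le_log {u : ℝ} (hp : 0 < p) (hp1 : p < 1) (hu : 0 ≤ u) :
    (u ^ p - 1) / p - p * (u - 1) ≤ Real.log ((1 - p) * u + p) := by
  set gap : ℝ → ℝ :=
    fun u => Real.log ((1 - p) * u + p) - ((u ^ p - 1) / p - p * (u - 1))
  have hderiv {u : ℝ} (hu : 0 < u) := hasDerivAt_logGap hp hp1 hu
  have hcont : ContinuousAt gap 0 := by
    have hpow : ContinuousAt (fun u : ℝ => u ^ p) 0 := Real.continuousAt_rpow_const _ _ (.inr hp.le)
    have hlog : ContinuousAt (fun u : ℝ => Real.log ((1 - p) * u + p)) 0 :=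
      (by fun_prop : ContinuousAt (fun u : ℝ => (1 - p) * u + p) 0).log (by simpa using hp.ne')
    exact hlog.sub (((hpow.sub continuousAt_const).div_const p).sub (by fun_prop))
  have hmin : IsMinOn gap (Ici 0) 1 := by
    refine isMinOn_Ici_of_deriv hcont (hderiv one_pos).continuousAt
      (fun u hu => (hderiv hu.1).differentiableAt.differentiableWithinAt)
      (fun u hu => (hderiv (one_pos.trans hu)).differentiableAt.differentiableWithinAt)
      (fun u hu => ?_) (fun u hu => ?_)
    · rw [(hderiv hu.1).deriv]
      linarith [div_add_le_rpow_sub_one hp hp1 hu.1 hu.2.le]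
    · rw [(hderiv (one_pos.trans hu)).deriv]
      linarith [rpow_sub_one_le_div_add hp hp1 (mem_Ioi.1 hu).le]
  have hgap : gap 1 ≤ gap u := hmin hu
  rw [show gap 1 = 0 by simp [gap]] at hgap
  exact sub_nonneg.1 hgap

lemma negLog_average_add_le {u m : ℝ≥0∞} (hp : 0 < p) (hp1 : p < 1) (hm0 : m ≠ 0) (hm : m ≤ 1)
    (hu : u ≤ 1) :
    negLog (ENNReal.ofReal (1 - p) * u + ENNReal.ofReal p * m) + ENNReal.ofReal p⁻¹ * (u / m) ^ p
        + ENNReal.ofReal p ≤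
      negLog m + ENNReal.ofReal p⁻¹ + ENNReal.ofReal p * (u / m) := by
  obtain ⟨x, hx, rfl⟩ := exists_pos_eq_ofReal hm0 (hm.trans_lt ENNReal.one_lt_top).ne
  obtain ⟨y, hy, rfl⟩ : ∃ y : ℝ, 0 ≤ y ∧ u = ENNReal.ofReal y :=
    ⟨u.toReal, ENNReal.toReal_nonneg,
      (ENNReal.ofReal_toReal (hu.trans_lt ENNReal.one_lt_top).ne).symm⟩
  have hx1 : x ≤ 1 := by simpa using hm
  have hy1 : y ≤ 1 := by simpa using hu
  have hq : 0 < 1 - p := sub_pos.2 hp1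
  have hpos : 0 < (1 - p) * y + p * x := by positivity
  have hlog : Real.log ((1 - p) * y + p * x) ≤ 0 := Real.log_nonpos hpos.le (by nlinarith)
  have hlogx : Real.log x ≤ 0 := Real.log_nonpos hx.le hx1
  have hsplit : Real.log ((1 - p) * (y / x) + p) = Real.log ((1 - p) * y + p * x) - Real.log x := by
    rw [← Real.log_div hpos.ne' hx.ne']
    congr 1
    field_simp
  have hmain := rpow_sub_one_div_sub_le_log hp hp1 (div_nonneg hy hx.le)
  rw [← ENNReal.ofReal_mul hq.le, ← ENNReal.ofReal_mul hp.le,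
    ← ENNReal.ofReal_add (by positivity) (by positivity), negLog_ofReal hpos, negLog_ofReal hx,
    ← ENNReal.ofReal_div_of_pos hx, ENNReal.ofReal_rpow_of_nonneg (by positivity) hp.le,
    ← ENNReal.ofReal_mul (by positivity), ← ENNReal.ofReal_mul hp.le,
    ← ENNReal.ofReal_add (by linarith) (by positivity),
    ← ENNReal.ofReal_add (add_nonneg (by linarith) (by positivity)) hp.le,
    ← ENNReal.ofReal_add (by linarith) (by positivity),
    ← ENNReal.ofReal_add (add_nonneg (by linarith) (by positivity)) (by positivity)]
  apply ENNReal.ofReal_le_ofReal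
  have hfrac : ((y / x) ^ p - 1) / p = p⁻¹ * (y / x) ^ p - p⁻¹ := by ring
  linarith

theorem lintegral_negLog_average_le {Ω : Type*} [MeasurableSpace Ω] (μ : Measure Ω)
    [IsProbabilityMeasure μ] (hp : 0 < p) (hp1 : p < 1) {f : Ω → ℝ≥0∞}
    (hf : Measurable f) (hf1 : ∀ y, f y ≤ 1) :
    ∫⁻ y, negLog (ENNReal.ofReal (1 - p) * f y + ENNReal.ofReal p * ∫⁻ z, f z ∂μ) ∂μ ≤
      ENNReal.ofReal p⁻¹ * negLog (∫⁻ z, f z ^ p ∂μ) := by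
  set m := ∫⁻ z, f z ∂μ
  set s := ∫⁻ z, f z ^ p ∂μ with hs
  have hs1 : s ≤ 1 := (lintegral_mono fun z => ENNReal.rpow_le_one (hf1 z) hp.le).trans (by simp)
  have hm1 : m ≤ 1 := (lintegral_mono hf1).trans (by simp)
  rcases eq_or_ne m 0 with hm0 | hm0
  · have hs0 : s = 0 := by
      rw [hs, lintegral_eq_zero_iff (hf.pow_const p)]
      filter_upwards [(lintegral_eq_zero_iff hf).1 hm0] with z hz
      simp [hz, hp]
    simp [hs0, hp]
  have hmtop : m ≠ ∞ := (hm1.trans_lt ENNReal.one_lt_top).ne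
  have hmp0 : m ^ p ≠ 0 := by simp [hm0, hmtop]
  have hs_top : s / m ^ p ≠ ∞ := ENNReal.div_ne_top (hs1.trans_lt ENNReal.one_lt_top).ne hmp0
  have hmean : ∫⁻ y, f y / m ∂μ = 1 := by
    simp only [div_eq_mul_inv]
    rw [lintegral_mul_const _ hf, ENNReal.mul_inv_cancel hm0 hmtop]
  have hmoment : ∫⁻ y, (f y / m) ^ p ∂μ = s / m ^ p := by
    simp only [ENNReal.div_rpow_of_nonneg _ _ hp.le]
    simp only [div_eq_mul_inv]
    rw [lintegral_mul_const _ (hf.pow_const p)]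
  have hintegrated := lintegral_mono (μ := μ) fun y =>
    negLog_average_add_le hp hp1 hm0 hm1 (hf1 y)
  rw [lintegral_add_right _ measurable_const, lintegral_add_right _ (by fun_prop),
    lintegral_const_mul _ (by fun_prop), lintegral_add_right _ (by fun_prop),
    lintegral_const_mul _ (by fun_prop), hmean, hmoment] at hintegrated
  simp only [lintegral_const, measure_univ, mul_one] at hintegrated
  have hgibbs : negLog m + ENNReal.ofReal p⁻¹ ≤
      ENNReal.ofReal p⁻¹ * negLog s + ENNReal.ofReal p⁻¹ * (s / m ^ p) :=
    calc negLog m + ENNReal.ofReal p⁻¹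
        = ENNReal.ofReal p⁻¹ * (negLog (m ^ p) + 1) := by
          rw [mul_add, ofReal_inv_mul_negLog_rpow hp, mul_one]
      _ ≤ ENNReal.ofReal p⁻¹ * (negLog s + s / m ^ p) :=
          mul_le_mul_right (negLog_add_one_le hmp0 (ENNReal.rpow_le_one hm1 hp.le) hs1) _
      _ = _ := mul_add _ _ _
  exact (ENNReal.add_le_add_iff_right (ENNReal.mul_ne_top ENNReal.ofReal_ne_top hs_top)).1
    (((ENNReal.add_le_add_iff_right ENNReal.ofReal_ne_top).1 hintegrated).trans hgibbs)

end OneDimensional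

section Minkowski

variable {α β : Type*} [MeasurableSpace α] [MeasurableSpace β] {q : ℝ}

lemma exists_measurable_le_lt_lintegral {ν : Measure β} [SigmaFinite ν] {f : β → ℝ≥0∞} {c : ℝ≥0∞}
    (hc : c < ∫⁻ b, f b ∂ν) :
    ∃ g : β → ℝ≥0∞, Measurable g ∧ g ≤ f ∧ ∫⁻ b, g b ∂ν < ∞ ∧ c < ∫⁻ b, g b ∂ν := by
  simp_rw [lintegral_eq_nnreal, lt_iSup_iff] at hc
  obtain ⟨φ, hφf, hcφ⟩ := hc
  rw [← SimpleFunc.lintegral_eq_lintegral] at hcφ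
  obtain ⟨g, hgφ, hg_lt_top, hcg⟩ :=
    SimpleFunc.exists_lt_lintegral_simpleFunc_of_lt_lintegral (f := φ) hcφ
  exact ⟨fun b => g b, by fun_prop,
    fun b => (ENNReal.coe_le_coe.2 (hgφ b)).trans (hφf b), hg_lt_top, hcg⟩

/- By duality: `∫ T ^ q ≤ ∫ T ^ (q - 1) * (∫ G a ∂μ)`, and after exchanging the integrals Hölder's
inequality bounds the inner one for each fixed `a`. -/
lemma lintegral_rpow_le_of_le_lintegral {μ : Measure α} {ν : Measure β} [SFinite μ] [SFinite ν]
    (hq : 1 < q) {G : α → β → ℝ≥0∞} (hG : Measurable (Function.uncurry G)) {T : β → ℝ≥0∞}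
    (hT : Measurable T) (hTG : ∀ b, T b ≤ ∫⁻ a, G a b ∂μ) (hfin : ∫⁻ b, T b ^ q ∂ν ≠ ∞) :
    (∫⁻ b, T b ^ q ∂ν) ^ (1 / q) ≤ ∫⁻ a, (∫⁻ b, G a b ^ q ∂ν) ^ (1 / q) ∂μ := by
  set A := ∫⁻ b, T b ^ q ∂ν
  have hconj : q.conjExponent.HolderConjugate q := (Real.HolderConjugate.conjExponent hq).symm
  have hholder (a : α) : ∫⁻ b, T b ^ (q - 1) * G a b ∂ν ≤
      A ^ (1 / q.conjExponent) * (∫⁻ b, G a b ^ q ∂ν) ^ (1 / q) := by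
    have := ENNReal.lintegral_mul_le_Lp_mul_Lq ν hconj (hT.pow_const (q - 1)).aemeasurable
      hG.of_uncurry_left.aemeasurable (g := G a)
    simp only [← ENNReal.rpow_mul, hconj.symm.sub_one_mul_conj] at this
    exact this
  have hdual : A ≤ A ^ (1 / q.conjExponent) * ∫⁻ a, (∫⁻ b, G a b ^ q ∂ν) ^ (1 / q) ∂μ :=
    calc A ≤ ∫⁻ b, ∫⁻ a, T b ^ (q - 1) * G a b ∂μ ∂ν := by
          refine lintegral_mono fun b => ?_
          rw [lintegral_const_mul _ hG.of_uncurry_right]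
          calc T b ^ q = T b ^ (q - 1) * T b := by
                conv_rhs => rw [← ENNReal.rpow_one (T b), ← ENNReal.rpow_mul, one_mul,
                  ← ENNReal.rpow_add_of_nonneg _ _ (sub_nonneg.2 hq.le) zero_le_one,
                  sub_add_cancel]
            _ ≤ T b ^ (q - 1) * ∫⁻ a, G a b ∂μ := by gcongr; exact hTG b
      _ = ∫⁻ a, ∫⁻ b, T b ^ (q - 1) * G a b ∂ν ∂μ := by
          refine lintegral_lintegral_swap (Measurable.aemeasurable ?_)
          exact ((hT.comp measurable_fst).pow_const _).mul (hG.comp measurable_swap)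
      _ ≤ ∫⁻ a, A ^ (1 / q.conjExponent) * (∫⁻ b, G a b ^ q ∂ν) ^ (1 / q) ∂μ :=
          lintegral_mono hholder
      _ = _ := lintegral_const_mul _ ((hG.pow_const q).lintegral_prod_right'.pow_const _)
  rcases eq_or_ne A 0 with hA0 | hA0
  · simp [hA0, one_pos.trans hq]
  have hsplit : A ^ (1 / q.conjExponent) * A ^ (1 / q) = A := by
    rw [← ENNReal.rpow_add _ _ hA0 hfin, one_div, one_div, hconj.inv_add_inv_eq_one,
      ENNReal.rpow_one]
  refine (ENNReal.mul_le_mul_iff_right ?_ ?_).1 (hsplit.trans_le hdual)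
  · simp [hA0, hfin]
  · exact ENNReal.rpow_ne_top_of_nonneg (one_div_nonneg.2 hconj.nonneg) hfin

theorem lintegral_minkowski (μ : Measure α) (ν : Measure β) [SFinite μ] [SigmaFinite ν]
    (hq : 1 ≤ q) {G : α → β → ℝ≥0∞} (hG : Measurable (Function.uncurry G)) :
    (∫⁻ b, (∫⁻ a, G a b ∂μ) ^ q ∂ν) ^ (1 / q) ≤ ∫⁻ a, (∫⁻ b, G a b ^ q ∂ν) ^ (1 / q) ∂μ := by
  rcases hq.eq_or_lt with rfl | hq
  · simpa using (lintegral_lintegral_swap hG.aemeasurable).ge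
  have hq0 : 0 < q := one_pos.trans hq
  rw [one_div, ENNReal.rpow_inv_le_iff hq0]
  refine le_of_forall_lt fun c hc => ?_
  obtain ⟨g, hg, hgle, hg_lt_top, hcg⟩ := exists_measurable_le_lt_lintegral hc
  have hroot : ∀ b, (g b ^ (1 / q)) ^ q = g b := fun b => by
    rw [← ENNReal.rpow_mul, one_div_mul_cancel hq0.ne', ENNReal.rpow_one]
  have hmink := lintegral_rpow_le_of_le_lintegral (ν := ν) hq hG (hg.pow_const (1 / q))
    (fun b => by rw [one_div, ENNReal.rpow_inv_le_iff hq0]; exact hgle b)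
    (by simpa only [hroot] using hg_lt_top.ne)
  simp only [hroot] at hmink
  rw [one_div, ENNReal.rpow_inv_le_iff hq0] at hmink
  exact hcg.trans_le hmink

end Minkowski

section ProductMeasure

variable {ι : Type*} [Fintype ι] {α β : ι → Type*} [∀ i, MeasurableSpace (α i)]
  [∀ i, MeasurableSpace (β i)]

lemma pi_mono {μ ν : ∀ i, Measure (α i)} [∀ i, SigmaFinite (μ i)] (h : ∀ i, μ i ≤ ν i) :
    Measure.pi μ ≤ Measure.pi ν := by
  have houter : (Measure.pi μ).toOuterMeasure ≤
      OuterMeasure.pi fun i => (ν i).toOuterMeasure := by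
    refine OuterMeasure.le_pi.2 fun s _ => ?_
    exact (Measure.pi_pi μ s).trans_le (Finset.prod_le_prod' fun i _ => h i (s i))
  refine Measure.le_iff.2 fun s hs => ?_
  rw [Measure.pi_def ν, toMeasure_apply _ _ hs]
  exact houter s

lemma pi_smul (c : ι → NNReal) (μ : ∀ i, Measure (α i)) [∀ i, SigmaFinite (μ i)] :
    Measure.pi (fun i => c i • μ i) = (∏ i, c i) • Measure.pi μ := by
  refine Measure.pi_eq fun s _ => ?_
  simp only [Measure.smul_apply, Measure.pi_pi, ENNReal.smul_def, smul_eq_mul,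
    Finset.prod_mul_distrib, ENNReal.ofNNReal_finsetProd]

/-- The product of the Markov kernels `κ i`: the coordinates of the output are independent given
the input, and the `i`-th one depends on the `i`-th input only. -/
noncomputable def productKernel (κ : ∀ i, Kernel (α i) (β i)) [∀ i, IsMarkovKernel (κ i)] :
    Kernel (∀ i, α i) (∀ i, β i) where
  toFun x := Measure.pi fun i => κ i (x i)
  measurable' := by
    refine Measurable.measure_of_isPiSystem_of_isProbabilityMeasure generateFrom_pi.symm
      isPiSystem_pi ?_
    rintro _ ⟨s, hs, rfl⟩
    simp only [Measure.pi_pi]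
    exact Finset.measurable_prod _ fun i _ =>
      ((κ i).measurable_coe (hs i (mem_univ i))).comp (measurable_pi_apply i)

lemma productKernel_apply (κ : ∀ i, Kernel (α i) (β i)) [∀ i, IsMarkovKernel (κ i)]
    (x : ∀ i, α i) : productKernel κ x = Measure.pi fun i => κ i (x i) := rfl

instance (κ : ∀ i, Kernel (α i) (β i)) [∀ i, IsMarkovKernel (κ i)] :
    IsMarkovKernel (productKernel κ) :=
  ⟨fun x => by rw [productKernel_apply]; infer_instance⟩

end ProductMeasure

/-- Reverse hypercontractivity of the channel `κ` from `L^p(ν)` to `L^0(μ)`, that is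
`‖κ f‖_{L^0(μ)} ≥ ‖f‖_{L^p(ν)}` for `0 ≤ f`, where `‖g‖_{L^0(μ)} = exp ∫ log g dμ`.
By homogeneity it suffices to consider `f ≤ 1`, for which `negLog` is not truncated. -/
def IsReverseHypercontractive {α β : Type*} [MeasurableSpace α] [MeasurableSpace β] (p : ℝ)
    (κ : Kernel α β) (μ : Measure α) (ν : Measure β) : Prop :=
  ∀ ⦃f : β → ℝ≥0∞⦄, Measurable f → (∀ z, f z ≤ 1) →
    ∫⁻ y, negLog (∫⁻ z, f z ∂κ y) ∂μ ≤ ENNReal.ofReal p⁻¹ * negLog (∫⁻ z, f z ^ p ∂ν)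

namespace IsReverseHypercontractive

variable {p : ℝ}

section Product

variable {α β γ δ : Type*} [MeasurableSpace α] [MeasurableSpace β] [MeasurableSpace γ]
  [MeasurableSpace δ]

lemma of_measurePreserving {κ : Kernel α β} {κ' : Kernel γ δ} [IsSFiniteKernel κ']
    {μ : Measure α} {μ' : Measure γ} {ν : Measure β} {ν' : Measure δ} {e : α → γ} {e' : β ≃ᵐ δ}
    (h : IsReverseHypercontractive p κ' μ' ν') (he : MeasurePreserving e μ μ')
    (he' : MeasurePreserving e' ν ν') (hκ : ∀ y, MeasurePreserving e' (κ y) (κ' (e y))) :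
    IsReverseHypercontractive p κ μ ν := by
  intro f hf hf1
  have hf' : Measurable fun z => f (e'.symm z) := hf.comp e'.symm.measurable
  calc ∫⁻ y, negLog (∫⁻ z, f z ∂κ y) ∂μ
      = ∫⁻ y, negLog (∫⁻ z, f (e'.symm z) ∂κ' (e y)) ∂μ := by
        refine lintegral_congr fun y => ?_
        rw [(hκ y).symm.lintegral_comp hf]
    _ = ∫⁻ y, negLog (∫⁻ z, f (e'.symm z) ∂κ' y) ∂μ' :=
        he.lintegral_comp (measurable_negLog.comp hf'.lintegral_kernel)
    _ ≤ ENNReal.ofReal p⁻¹ * negLog (∫⁻ z, f (e'.symm z) ^ p ∂ν') := h hf' fun z => hf1 _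
    _ = ENNReal.ofReal p⁻¹ * negLog (∫⁻ z, f z ^ p ∂ν) := by
        rw [he'.symm.lintegral_comp (hf.pow_const p)]

theorem prod (hp : 0 < p) (hp1 : p ≤ 1) {κ : Kernel α β} {η : Kernel γ δ} [IsSFiniteKernel κ]
    [IsMarkovKernel η] {μ : Measure α} {ν : Measure β} {ρ : Measure γ} {σ : Measure δ}
    [SFinite μ] [IsProbabilityMeasure ν] [SFinite ρ] [SFinite σ]
    (hκ : IsReverseHypercontractive p κ μ ν) (hη : IsReverseHypercontractive p η ρ σ) :
    IsReverseHypercontractive p (κ ∥ₖ η) (μ.prod ρ) (ν.prod σ) := by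
  intro f hf hf1
  have hfp : Measurable fun z => f z ^ p := hf.pow_const p
  set g : δ → ℝ≥0∞ := fun w => (∫⁻ z, f (z, w) ^ p ∂ν) ^ p⁻¹
  have hg : Measurable g := hfp.lintegral_prod_left'.pow_const _
  have hg1 : ∀ w, g w ≤ 1 := fun w => ENNReal.rpow_le_one
    ((lintegral_mono fun z => ENNReal.rpow_le_one (hf1 (z, w)) hp.le).trans (by simp))
    (by positivity)
  have hgp : ∫⁻ w, g w ^ p ∂σ = ∫⁻ z, f z ^ p ∂ν.prod σ := by
    simp_rw [g, ENNReal.rpow_inv_rpow hp.ne']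
    exact (lintegral_prod_symm' _ hfp).symm
  have hfirst (v : γ) : ∫⁻ y, negLog (∫⁻ z, ∫⁻ w, f (z, w) ∂η v ∂κ y) ∂μ ≤
      negLog (∫⁻ w, g w ∂η v) := by
    have hmink : (∫⁻ w, g w ∂η v) ^ p ≤ ∫⁻ z, (∫⁻ w, f (z, w) ∂η v) ^ p ∂ν := by
      have := lintegral_minkowski ν (η v) ((one_le_inv₀ hp).2 hp1)
        (G := fun z w => f (z, w) ^ p) hfp
      simpa only [one_div, inv_inv, ENNReal.rpow_rpow_inv hp.ne'] using this
    calc ∫⁻ y, negLog (∫⁻ z, ∫⁻ w, f (z, w) ∂η v ∂κ y) ∂μ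
        ≤ ENNReal.ofReal p⁻¹ * negLog (∫⁻ z, (∫⁻ w, f (z, w) ∂η v) ^ p ∂ν) :=
          hκ hf.lintegral_prod_right' fun z => (lintegral_mono fun w => hf1 (z, w)).trans (by simp)
      _ ≤ ENNReal.ofReal p⁻¹ * negLog ((∫⁻ w, g w ∂η v) ^ p) := by
          gcongr
          exact antitone_negLog hmink
      _ = negLog (∫⁻ w, g w ∂η v) := ofReal_inv_mul_negLog_rpow hp _
  calc ∫⁻ y, negLog (∫⁻ z, f z ∂(κ ∥ₖ η) y) ∂μ.prod ρ
      = ∫⁻ v, ∫⁻ y, negLog (∫⁻ z, ∫⁻ w, f (z, w) ∂η v ∂κ y) ∂μ ∂ρ := by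
        have hκη : Measurable fun y => negLog (∫⁻ z, f z ∂(κ ∥ₖ η) y) :=
          measurable_negLog.comp hf.lintegral_kernel
        rw [lintegral_prod_symm' _ hκη]
        simp_rw [Kernel.parallelComp_apply, lintegral_prod _ hf.aemeasurable]
    _ ≤ ∫⁻ v, negLog (∫⁻ w, g w ∂η v) ∂ρ := lintegral_mono hfirst
    _ ≤ ENNReal.ofReal p⁻¹ * negLog (∫⁻ z, f z ^ p ∂ν.prod σ) := hgp ▸ hη hg hg1

end Product

theorem pi (hp : 0 < p) (hp1 : p ≤ 1) {n : ℕ} {α β : Fin n → Type*} [∀ i, MeasurableSpace (α i)]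
    [∀ i, MeasurableSpace (β i)] {κ : ∀ i, Kernel (α i) (β i)} {μ : ∀ i, Measure (α i)}
    {ν : ∀ i, Measure (β i)} [∀ i, IsMarkovKernel (κ i)] [∀ i, IsProbabilityMeasure (μ i)]
    [∀ i, IsProbabilityMeasure (ν i)] (h : ∀ i, IsReverseHypercontractive p (κ i) (μ i) (ν i)) :
    IsReverseHypercontractive p (productKernel κ) (Measure.pi μ) (Measure.pi ν) := by
  induction n with
  | zero =>
    intro f _ _
    have hpi (ρ : ∀ i, Measure (β i)) : Measure.pi ρ = Measure.dirac isEmptyElim :=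
      Measure.pi_of_empty ρ _
    simp [productKernel_apply, hpi, ofReal_inv_mul_negLog_rpow hp]
  | succ n ih =>
    exact of_measurePreserving
      (prod hp hp1 (h 0) (ih fun j => h (Fin.succAbove 0 j)))
      (measurePreserving_piFinSuccAbove μ 0) (measurePreserving_piFinSuccAbove ν 0) fun y => by
        rw [Kernel.parallelComp_apply]
        exact measurePreserving_piFinSuccAbove (fun i => κ i (y i)) 0

end IsReverseHypercontractive

section AverageKernel

variable {Ω : Type*} [MeasurableSpace Ω] {p : ℝ}

/-- The averaging operator `(1 - p) id + p 𝔼_μ`: keep the input with probability `1 - p`, and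
replace it with an independent sample of `μ` otherwise. -/
noncomputable def averageKernel (p : ℝ) (μ : Measure Ω) : Kernel Ω Ω where
  toFun y := ENNReal.ofReal (1 - p) • Measure.dirac y + ENNReal.ofReal p • μ
  measurable' := by
    refine Measure.measurable_of_measurable_coe _ fun s hs => ?_
    simp only [Measure.add_apply, Measure.smul_apply, smul_eq_mul]
    exact ((Measure.measurable_coe hs).comp Measure.measurable_dirac).const_mul _ |>.add_const _

lemma averageKernel_apply (p : ℝ) (μ : Measure Ω) (y : Ω) :
    averageKernel p μ y = ENNReal.ofReal (1 - p) • Measure.dirac y + ENNReal.ofReal p • μ := rfl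

lemma isMarkovKernel_averageKernel (hp : p ∈ Icc (0 : ℝ) 1) (μ : Measure Ω)
    [IsProbabilityMeasure μ] : IsMarkovKernel (averageKernel p μ) :=
  ⟨fun y => ⟨by
    simp [averageKernel_apply, ← ENNReal.ofReal_add (sub_nonneg.2 hp.2) hp.1]⟩⟩

lemma isReverseHypercontractive_averageKernel (hp : 0 < p) (hp1 : p < 1) (μ : Measure Ω)
    [IsProbabilityMeasure μ] : IsReverseHypercontractive p (averageKernel p μ) μ μ := by
  intro f hf hf1
  simp_rw [averageKernel_apply, lintegral_add_measure, lintegral_smul_measure,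
    lintegral_dirac' _ hf]
  exact lintegral_negLog_average_le μ hp hp1 hf hf1

/-- The parameter `s` for which `μ ≤ α • ν` makes `averageKernel p μ` at most
`(1 + (α - 1) p) • averageKernel s ν`. Comparing the weights of the identity and of `ν` gives
`1 - p = c (1 - s)` and `p α = c s`, hence `c = 1 + (α - 1) p` and `s = α p / c`. -/
noncomputable def dominatingRate (α p : ℝ) : ℝ := α * p / (1 + (α - 1) * p)

variable {α : ℝ}

lemma one_le_one_add_sub_one_mul (hα : 1 ≤ α) (hp : 0 ≤ p) : 1 ≤ 1 + (α - 1) * p :=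
  le_add_of_nonneg_right (mul_nonneg (sub_nonneg.2 hα) hp)

lemma dominatingRate_mem_Icc (hα : 1 ≤ α) (hp : p ∈ Icc (0 : ℝ) 1) :
    dominatingRate α p ∈ Icc (0 : ℝ) 1 := by
  have hc := one_pos.trans_le (one_le_one_add_sub_one_mul hα hp.1)
  refine ⟨div_nonneg (mul_nonneg (zero_le_one.trans hα) hp.1) hc.le, (div_le_one hc).2 ?_⟩
  linarith [hp.2]

lemma averageKernel_le_smul {μ ν : Measure Ω} (hα : 1 ≤ α) (hp : 0 ≤ p)
    (hμν : μ ≤ ENNReal.ofReal α • ν) (y : Ω) :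
    averageKernel p μ y ≤
      ENNReal.ofReal (1 + (α - 1) * p) • averageKernel (dominatingRate α p) ν y := by
  have hc := one_pos.trans_le (one_le_one_add_sub_one_mul hα hp)
  have hstay : (1 + (α - 1) * p) * (1 - dominatingRate α p) = 1 - p := by
    rw [dominatingRate]
    field_simp
    ring
  have hresample : (1 + (α - 1) * p) * dominatingRate α p = p * α := by
    rw [dominatingRate]
    field_simp
  rw [averageKernel_apply, averageKernel_apply, smul_add, smul_smul, smul_smul,
    ← ENNReal.ofReal_mul hc.le, ← ENNReal.ofReal_mul hc.le, hstay, hresample,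
    ENNReal.ofReal_mul hp, mul_smul]
  gcongr

end AverageKernel

section Smoothing

variable {n : ℕ} {Ω : Fin n → Type*} [∀ i, MeasurableSpace (Ω i)] {μ ν : ∀ i, Measure (Ω i)}
  {α p : ℝ}

lemma pi_averageKernel_le_smul [∀ i, IsProbabilityMeasure (μ i)] [∀ i, IsProbabilityMeasure (ν i)]
    (hα : 1 ≤ α) (hp : p ∈ Icc (0 : ℝ) 1) (hμν : ∀ i, μ i ≤ ENNReal.ofReal α • ν i)
    (y : ∀ i, Ω i) :
    Measure.pi (fun i => averageKernel p (μ i) (y i)) ≤ ENNReal.ofReal ((1 + (α - 1) * p) ^ n) •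
      Measure.pi fun i => averageKernel (dominatingRate α p) (ν i) (y i) := by
  have := fun i => isMarkovKernel_averageKernel hp (μ i)
  have := fun i => isMarkovKernel_averageKernel (dominatingRate_mem_Icc hα hp) (ν i)
  have hc := zero_le_one.trans (one_le_one_add_sub_one_mul hα hp.1)
  refine (pi_mono fun i => averageKernel_le_smul hα hp.1 (hμν i) (y i)).trans_eq ?_
  refine (pi_smul (fun _ => (1 + (α - 1) * p).toNNReal) _).trans ?_
  rw [Finset.prod_const, Finset.card_univ, Fintype.card_fin, ← Real.toNNReal_pow hc]
  rfl

theorem lintegral_negLog_smoothing_le [∀ i, IsProbabilityMeasure (μ i)]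
    [∀ i, IsProbabilityMeasure (ν i)] (hα : 1 ≤ α) (hp : 0 < p) (hp1 : p < 1)
    (hμν : ∀ i, μ i ≤ ENNReal.ofReal α • ν i) {f : (∀ i, Ω i) → ℝ≥0∞} (hf : Measurable f)
    (hf1 : ∀ z, f z ≤ 1) :
    ∫⁻ y, negLog (∫⁻ z, f z ∂Measure.pi fun i =>
        averageKernel (dominatingRate α p) (ν i) (y i)) ∂Measure.pi μ ≤
      ENNReal.ofReal (n * Real.log (1 + (α - 1) * p)) +
        ENNReal.ofReal p⁻¹ * negLog (∫⁻ z, f z ∂Measure.pi μ) := by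
  have hM := fun i => isMarkovKernel_averageKernel ⟨hp.le, hp1.le⟩ (μ i)
  set c := 1 + (α - 1) * p
  have hc : 0 < c := one_pos.trans_le (one_le_one_add_sub_one_mul hα hp.le)
  have hrhc := IsReverseHypercontractive.pi hp hp1.le fun i =>
    isReverseHypercontractive_averageKernel hp hp1 (μ i)
  calc ∫⁻ y, negLog (∫⁻ z, f z ∂Measure.pi fun i =>
        averageKernel (dominatingRate α p) (ν i) (y i)) ∂Measure.pi μ
      ≤ ∫⁻ y, (ENNReal.ofReal (n * Real.log c) + negLog (∫⁻ z, f z ∂Measure.pi fun i =>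
          averageKernel p (μ i) (y i))) ∂Measure.pi μ := by
        refine lintegral_mono fun y => ?_
        rw [← Real.log_pow]
        refine negLog_le_log_add_of_le_mul (pow_pos hc n) ?_
        rw [← smul_eq_mul, ← lintegral_smul_measure]
        exact lintegral_mono' (pi_averageKernel_le_smul hα ⟨hp.le, hp1.le⟩ hμν y) le_rfl
    _ = ENNReal.ofReal (n * Real.log c) + ∫⁻ y, negLog (∫⁻ z, f z ∂Measure.pi fun i =>
          averageKernel p (μ i) (y i)) ∂Measure.pi μ := by
        rw [lintegral_add_left measurable_const]
        simp
    _ ≤ ENNReal.ofReal (n * Real.log c) +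
          ENNReal.ofReal p⁻¹ * negLog (∫⁻ z, f z ^ p ∂Measure.pi μ) := by
        gcongr
        exact hrhc hf hf1
    _ ≤ ENNReal.ofReal (n * Real.log c) +
          ENNReal.ofReal p⁻¹ * negLog (∫⁻ z, f z ∂Measure.pi μ) := by
        gcongr
        refine antitone_negLog (lintegral_mono fun z => ?_)
        simpa using ENNReal.rpow_le_rpow_of_exponent_ge (hf1 z) hp1.le

end Smoothing

section CondLaw

variable {S 𝓐 𝓑 𝓒 : Type*} [MeasurableSpace S] [MeasurableSpace 𝓐] [MeasurableSpace 𝓑]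
  [MeasurableSpace 𝓒] {P : Measure S} [IsFiniteMeasure P] {A : S → 𝓐} {B : S → 𝓑} {C : S → 𝓒}

lemma hasCondLaw_iff_lintegral {κ : Kernel 𝓐 𝓑} [IsSFiniteKernel κ] (hA : Measurable A)
    (hB : Measurable B) : HasCondLaw P B A κ ↔ ∀ g : 𝓐 × 𝓑 → ℝ≥0∞, Measurable g →
      ∫⁻ ω, g (A ω, B ω) ∂P = ∫⁻ ω, ∫⁻ b, g (A ω, b) ∂κ (A ω) ∂P := by
  refine (Measure.ext_iff_lintegral _).trans (forall₂_congr fun g hg => ?_)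
  rw [lintegral_map hg (hA.prodMk hB), Measure.lintegral_compProd hg,
    lintegral_map hg.lintegral_kernel_prod_right' hA]

lemma hasCondLaw_iff_setLIntegral {κ : Kernel 𝓐 𝓑} [IsMarkovKernel κ] (hA : Measurable A)
    (hB : Measurable B) : HasCondLaw P B A κ ↔ ∀ {s : Set 𝓐} {t : Set 𝓑}, MeasurableSet s →
      MeasurableSet t → P (A ⁻¹' s ∩ B ⁻¹' t) = ∫⁻ a in s, κ a t ∂P.map A := by
  refine Measure.ext_prod_iff.trans (forall₂_congr fun s t => forall₂_congr fun hs ht => ?_)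
  rw [Measure.map_apply (hA.prodMk hB) (hs.prod ht), Measure.compProd_apply_prod hs ht]
  rfl

namespace HasCondLaw

lemma lintegral_eq {κ : Kernel 𝓐 𝓑} [IsSFiniteKernel κ] (h : HasCondLaw P B A κ)
    (hA : Measurable A) (hB : Measurable B) {g : 𝓐 × 𝓑 → ℝ≥0∞} (hg : Measurable g) :
    ∫⁻ ω, g (A ω, B ω) ∂P = ∫⁻ ω, ∫⁻ b, g (A ω, b) ∂κ (A ω) ∂P :=
  (hasCondLaw_iff_lintegral hA hB).1 h g hg

lemma apply_ae_eq {κ η : Kernel 𝓐 𝓑} [IsMarkovKernel κ] [IsMarkovKernel η]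
    (hκ : HasCondLaw P B A κ) (hη : HasCondLaw P B A η) (hA : Measurable A) (hB : Measurable B)
    {t : Set 𝓑} (ht : MeasurableSet t) : ∀ᵐ a ∂P.map A, κ a t = η a t := by
  refine ae_eq_of_forall_setLIntegral_eq_of_sigmaFinite (κ.measurable_coe ht)
    (η.measurable_coe ht) fun s hs _ => ?_
  rw [← (hasCondLaw_iff_setLIntegral hA hB).1 hκ hs ht,
    ← (hasCondLaw_iff_setLIntegral hA hB).1 hη hs ht]

lemma of_prodMkRight {κ : Kernel 𝓐 𝓑} [IsSFiniteKernel κ] (hA : Measurable A)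
    (hB : Measurable B) (hC : Measurable C)
    (h : HasCondLaw P B (fun ω => (A ω, C ω)) (κ.prodMkRight 𝓒)) : HasCondLaw P B A κ := by
  refine (hasCondLaw_iff_lintegral hA hB).2 fun g hg => ?_
  exact h.lintegral_eq (hA.prodMk hC) hB (g := fun q => g (q.1.1, q.2)) (by fun_prop)

lemma comp {κ : Kernel 𝓑 𝓒} {η : Kernel 𝓐 𝓑} [IsMarkovKernel κ] [IsMarkovKernel η]
    (hA : Measurable A) (hB : Measurable B) (hC : Measurable C)
    (hκ : HasCondLaw P C (fun ω => (B ω, A ω)) (κ.prodMkRight 𝓐)) (hη : HasCondLaw P B A η) :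
    HasCondLaw P C A (κ ∘ₖ η) := by
  refine (hasCondLaw_iff_lintegral hA hC).2 fun g hg => ?_
  calc ∫⁻ ω, g (A ω, C ω) ∂P
      = ∫⁻ ω, ∫⁻ c, g (A ω, c) ∂κ (B ω) ∂P :=
        hκ.lintegral_eq (hB.prodMk hA) hC (g := fun q => g (q.1.2, q.2)) (by fun_prop)
    _ = ∫⁻ ω, ∫⁻ b, ∫⁻ c, g (A ω, c) ∂κ b ∂η (A ω) ∂P := by
        have hint : Measurable fun q : 𝓐 × 𝓑 => ∫⁻ c, g (q.1, c) ∂κ q.2 :=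
          (hg.comp (by fun_prop : Measurable fun q : (𝓐 × 𝓑) × 𝓒 => (q.1.1, q.2)))
            |>.lintegral_kernel_prod_right' (κ := κ.prodMkLeft 𝓐)
        exact hη.lintegral_eq hA hB hint
    _ = ∫⁻ ω, ∫⁻ c, g (A ω, c) ∂(κ ∘ₖ η) (A ω) ∂P := by
        refine lintegral_congr fun ω => (Kernel.lintegral_comp κ η (A ω) ?_).symm
        exact hg.comp measurable_prodMk_left

end HasCondLaw

lemma IsMarkovTriple.hasCondLaw_prodMkRight (hABC : IsMarkovTriple P A B C) {κ : Kernel 𝓑 𝓐}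
    [IsMarkovKernel κ] (hκ : HasCondLaw P A B κ) (hA : Measurable A) (hB : Measurable B)
    (hC : Measurable C) : HasCondLaw P A (fun ω => (B ω, C ω)) (κ.prodMkRight 𝓒) := by
  obtain ⟨η, _, hη⟩ := hABC
  refine (hasCondLaw_iff_setLIntegral (hB.prodMk hC) hA).2 fun {s t} hs ht => ?_
  rw [(hasCondLaw_iff_setLIntegral (hB.prodMk hC) hA).1 hη hs ht]
  have hηκ : ∀ᵐ ω ∂P, η (B ω) t = κ (B ω) t := ae_of_ae_map hB.aemeasurable
    ((hη.of_prodMkRight hB hA hC).apply_ae_eq hκ hB hA ht)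
  have hηκ_map : ∀ᵐ q ∂P.map fun ω => (B ω, C ω),
      η.prodMkRight 𝓒 q t = κ.prodMkRight 𝓒 q t :=
    (ae_map_iff (hB.prodMk hC).aemeasurable (measurableSet_eq_fun
      (Kernel.measurable_coe _ ht) (Kernel.measurable_coe _ ht))).2 hηκ
  exact setLIntegral_congr_fun_ae hs (hηκ_map.mono fun _ h _ => h)

theorem IsMarkovQuadruple.exists_hasCondLaw_comp {𝓓 : Type*} [MeasurableSpace 𝓓] {D : S → 𝓓}
    (hABCD : IsMarkovQuadruple P A B C D) {η : Kernel 𝓒 𝓑} [IsMarkovKernel η]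
    (hη : HasCondLaw P B C η) (hA : Measurable A) (hB : Measurable B) (hC : Measurable C)
    (hD : Measurable D) : ∃ κ : Kernel 𝓑 𝓐, IsMarkovKernel κ ∧
      HasCondLaw P A (fun ω => (C ω, D ω)) ((κ ∘ₖ η).prodMkRight 𝓓) := by
  obtain ⟨⟨κ, hκM, hκ⟩, hBCD⟩ := hABCD
  refine ⟨κ, hκM, ?_⟩
  have hcomp : (κ ∘ₖ η).prodMkRight 𝓓 = κ ∘ₖ η.prodMkRight 𝓓 := by
    ext q
    simp [Kernel.comp_apply]
  rw [hcomp]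
  exact hκ.comp (hC.prodMk hD) hB hA (hBCD.hasCondLaw_prodMkRight hη hB hC hD)

end CondLaw

section Entropy

variable {S ι 𝓐 𝓑 : Type*} [MeasurableSpace S] [MeasurableSpace ι] [Countable ι]
  [DiscreteMeasurableSpace ι] [MeasurableSpace 𝓐] [MeasurableSpace 𝓑]

lemma tsum_measure_singleton (μ : Measure ι) : ∑' i, μ {i} = μ univ := by
  rw [← lintegral_one, lintegral_countable']
  simp

lemma lintegral_negLog_singleton_le (μ ν : Measure ι) [IsProbabilityMeasure μ]
    [IsProbabilityMeasure ν] : ∫⁻ i, negLog (μ {i}) ∂μ ≤ ∫⁻ i, negLog (ν {i}) ∂μ := by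
  simp_rw [lintegral_countable', mul_comm _ (μ _)]
  exact tsum_mul_negLog_self_le (by rw [tsum_measure_singleton, measure_univ])
    (by rw [tsum_measure_singleton, measure_univ])

lemma measurable_negLog_singleton (κ : Kernel 𝓑 ι) :
    Measurable fun q : 𝓑 × ι => negLog (κ q.1 {q.2}) :=
  measurable_from_prod_countable_left fun i =>
    measurable_negLog.comp (κ.measurable_coe (measurableSet_singleton i))

variable [Nonempty ι] {P : Measure S} {I : S → ι} {X : S → 𝓐} {Y : S → 𝓑}

theorem condEntropy_eq_lintegral_negLog [IsFiniteMeasure P] {κ : Kernel 𝓑 ι} [IsMarkovKernel κ]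
    (h : HasCondLaw P I Y κ) (hI : Measurable I) (hY : Measurable Y) :
    condEntropy P I Y = ∫⁻ ω, negLog (κ (Y ω) {I ω}) ∂P :=
  calc condEntropy P I Y
      = ∫⁻ y, ∫⁻ i, negLog (κ y {i}) ∂κ y ∂P.map Y := by
        refine lintegral_congr_ae ?_
        filter_upwards [condDistrib_ae_eq_of_measure_eq_compProd Y hI.aemeasurable h] with y hy
        simp_rw [lintegral_countable', mul_comm _ (κ y _), mul_negLog_self, hy]
        rfl
    _ = ∫⁻ ω, ∫⁻ i, negLog (κ (Y ω) {i}) ∂κ (Y ω) ∂P :=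
        lintegral_map (measurable_negLog_singleton κ).lintegral_kernel_prod_right' hY
    _ = ∫⁻ ω, negLog (κ (Y ω) {I ω}) ∂P :=
        (h.lintegral_eq hY hI (measurable_negLog_singleton κ)).symm

theorem condEntropy_le_lintegral_negLog [IsFiniteMeasure P] (η : Kernel 𝓑 ι) [IsMarkovKernel η]
    (hI : Measurable I) (hY : Measurable Y) :
    condEntropy P I Y ≤ ∫⁻ ω, negLog (η (Y ω) {I ω}) ∂P := by
  have hlaw : HasCondLaw P I Y (condDistrib I Y P) :=
    (compProd_map_condDistrib hI.aemeasurable).symm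
  rw [condEntropy_eq_lintegral_negLog hlaw hI hY,
    hlaw.lintegral_eq hY hI (measurable_negLog_singleton _),
    hlaw.lintegral_eq hY hI (measurable_negLog_singleton _)]
  exact lintegral_mono fun ω =>
    lintegral_negLog_singleton_le (condDistrib I Y P (Y ω)) (η (Y ω))

theorem condEntropy_le_add_mul_of_lintegral_negLog_le [IsProbabilityMeasure P] {ρ : Kernel 𝓐 ι}
    [IsMarkovKernel ρ] {V : Kernel 𝓐 𝓑} [IsMarkovKernel V] {η : Kernel 𝓑 ι} [IsMarkovKernel η]
    (hI : Measurable I) (hX : Measurable X) (hY : Measurable Y)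
    (hρ : HasCondLaw P I (fun ω => (X ω, Y ω)) (ρ.prodMkRight 𝓑)) (hV : HasCondLaw P Y X V)
    {a b : ℝ≥0∞} (h : ∀ x i, ∫⁻ y, negLog (η y {i}) ∂V x ≤ a + b * negLog (ρ x {i})) :
    condEntropy P I Y ≤ a + b * condEntropy P I X := by
  have hρX : HasCondLaw P I X ρ := hρ.of_prodMkRight hX hI hY
  have hη := measurable_negLog_singleton η
  have hηX : Measurable fun q : (𝓐 × 𝓑) × ι => negLog (η q.1.2 {q.2}) :=
    hη.comp (by fun_prop : Measurable fun q : (𝓐 × 𝓑) × ι => (q.1.2, q.2))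
  have hent : Measurable fun x => ∫⁻ i, negLog (ρ x {i}) ∂ρ x :=
    (measurable_negLog_singleton ρ).lintegral_kernel_prod_right'
  calc condEntropy P I Y
      ≤ ∫⁻ ω, negLog (η (Y ω) {I ω}) ∂P := condEntropy_le_lintegral_negLog η hI hY
    _ = ∫⁻ ω, ∫⁻ i, negLog (η (Y ω) {i}) ∂ρ (X ω) ∂P := hρ.lintegral_eq (hX.prodMk hY) hI hηX
    _ = ∫⁻ ω, ∫⁻ y, ∫⁻ i, negLog (η y {i}) ∂ρ (X ω) ∂V (X ω) ∂P :=
        hV.lintegral_eq hX hY (hηX.lintegral_kernel_prod_right' (κ := ρ.prodMkRight 𝓑))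
    _ = ∫⁻ ω, ∫⁻ i, ∫⁻ y, negLog (η y {i}) ∂V (X ω) ∂ρ (X ω) ∂P :=
        lintegral_congr fun ω => lintegral_lintegral_swap hη.aemeasurable
    _ ≤ ∫⁻ ω, ∫⁻ i, (a + b * negLog (ρ (X ω) {i})) ∂ρ (X ω) ∂P :=
        lintegral_mono fun ω => lintegral_mono fun i => h (X ω) i
    _ = ∫⁻ ω, (a + b * ∫⁻ i, negLog (ρ (X ω) {i}) ∂ρ (X ω)) ∂P := by
        refine lintegral_congr fun ω => ?_
        rw [lintegral_add_left measurable_const, lintegral_const_mul _ (.of_discrete)]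
        simp
    _ = a + b * ∫⁻ ω, ∫⁻ i, negLog (ρ (X ω) {i}) ∂ρ (X ω) ∂P := by
        rw [lintegral_add_left measurable_const, lintegral_const_mul b]
        · simp
        · exact hent.comp hX
    _ = a + b * condEntropy P I X := by
        rw [condEntropy_eq_lintegral_negLog hρX hI hX,
          hρX.lintegral_eq hX hI (measurable_negLog_singleton ρ)]

end Entropy

section DensityBound

lemma essSup_rnDeriv_le_iff {Ω : Type*} [MeasurableSpace Ω] {μ ν : Measure Ω} [SigmaFinite μ]
    [SigmaFinite ν] (h : μ ≪ ν) {c : ℝ≥0∞} : essSup (μ.rnDeriv ν) ν ≤ c ↔ μ ≤ c • ν := by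
  constructor
  · intro hc
    calc μ = ν.withDensity (μ.rnDeriv ν) := (Measure.withDensity_rnDeriv_eq μ ν h).symm
      _ ≤ ν.withDensity fun _ => c :=
          withDensity_mono ((ENNReal.ae_le_essSup _).mono fun _ h => h.trans hc)
      _ = c • ν := withDensity_const c
  · intro hc
    refine essSup_le_of_ae_le _ (ae_le_of_forall_setLIntegral_le_of_sigmaFinite
      (Measure.measurable_rnDeriv μ ν) fun s _ _ => ?_)
    calc ∫⁻ y in s, μ.rnDeriv ν y ∂ν ≤ μ s := Measure.setLIntegral_rnDeriv_le s
      _ ≤ (c • ν) s := hc s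
      _ = ∫⁻ _ in s, c ∂ν := by simp

variable {𝓧 Ω : Type*} [MeasurableSpace 𝓧] [MeasurableSpace Ω] {W : Kernel 𝓧 Ω}
  {Q : Measure Ω}

lemma densityBound_le_iff [IsFiniteKernel W] [SigmaFinite Q] (h : ∀ x, W x ≪ Q) {c : ℝ≥0∞} :
    densityBound W Q ≤ c ↔ ∀ x, W x ≤ c • Q :=
  iSup_le_iff.trans (forall_congr' fun x => essSup_rnDeriv_le_iff (h x))

lemma le_densityBound_smul [IsFiniteKernel W] [SigmaFinite Q] (h : ∀ x, W x ≪ Q) (x : 𝓧) :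
    W x ≤ densityBound W Q • Q :=
  (densityBound_le_iff h).1 le_rfl x

lemma one_le_densityBound [Nonempty 𝓧] [IsMarkovKernel W] [IsProbabilityMeasure Q]
    (h : ∀ x, W x ≪ Q) : 1 ≤ densityBound W Q := by
  obtain ⟨x⟩ := ‹Nonempty 𝓧›
  simpa using le_densityBound_smul h x univ

end DensityBound

section MarkovChain

variable {𝓧 Ω S ι : Type*} [MeasurableSpace 𝓧] [MeasurableSpace Ω] [MeasurableSpace S]
  [MeasurableSpace ι] [Countable ι] [DiscreteMeasurableSpace ι] [Nonempty ι] {W : Kernel 𝓧 Ω}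
  [IsMarkovKernel W] {Q : Measure Ω} [IsProbabilityMeasure Q] {α : ℝ} {n : ℕ} {P : Measure S}
  [IsProbabilityMeasure P] {I : S → ι} {Z : S → Fin n → Ω} {X : S → Fin n → 𝓧}
  {Y : S → Fin n → Ω}

theorem condEntropy_le_log_add_inv_mul (hα : 1 ≤ α) (hW : ∀ x, W x ≤ ENNReal.ofReal α • Q)
    (hI : Measurable I) (hZ : Measurable Z) (hX : Measurable X) (hY : Measurable Y)
    (hM : IsMarkovQuadruple P I Z X Y) (hYX : HasCondLaw P Y X (memoryless W n))
    (hZX : HasCondLaw P Z X (memoryless W n)) {p : ℝ} (hp : 0 < p) (hp1 : p < 1) :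
    condEntropy P I Y ≤ ENNReal.ofReal (n * Real.log (1 + (α - 1) * p)) +
      ENNReal.ofReal p⁻¹ * condEntropy P I X := by
  obtain ⟨κ, _, hκ⟩ := hM.exists_hasCondLaw_comp hZX hI hZ hX hY
  have hsmooth :=
    isMarkovKernel_averageKernel (dominatingRate_mem_Icc hα ⟨hp.le, hp1.le⟩) Q
  refine condEntropy_le_add_mul_of_lintegral_negLog_le hI hX hY hκ hYX
    (η := κ ∘ₖ productKernel fun _ : Fin n => averageKernel (dominatingRate α p) Q) fun x i => ?_
  simp_rw [Kernel.comp_apply' _ _ _ (measurableSet_singleton i)]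
  exact lintegral_negLog_smoothing_le hα hp hp1 (fun j => hW (x j))
    (κ.measurable_coe (measurableSet_singleton i)) fun z => prob_le_one

lemma log_one_add_mul_one_sub_exp_neg_le (hα : 1 ≤ α) {t : ℝ} (ht : 0 ≤ t) :
    Real.log (1 + (α - 1) * (1 - Real.exp (-t))) ≤ (α - 1) * t := by
  have : 0 ≤ α - 1 := sub_nonneg.2 hα
  have hpos : 0 < 1 + (α - 1) * (1 - Real.exp (-t)) :=
    one_pos.trans_le (one_le_one_add_sub_one_mul hα (by simpa using ht))
  calc Real.log (1 + (α - 1) * (1 - Real.exp (-t)))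
      ≤ (α - 1) * (1 - Real.exp (-t)) := (Real.log_le_sub_one_of_pos hpos).trans_eq (by ring)
    _ ≤ (α - 1) * t := by gcongr; linarith [Real.add_one_le_exp (-t)]

lemma condEntropy_le_boundValue (hα : 1 ≤ α) (hW : ∀ x, W x ≤ ENNReal.ofReal α • Q)
    (hI : Measurable I) (hZ : Measurable Z) (hX : Measurable X) (hY : Measurable Y)
    (hM : IsMarkovQuadruple P I Z X Y) (hYX : HasCondLaw P Y X (memoryless W n))
    (hZX : HasCondLaw P Z X (memoryless W n)) {t : ℝ} (ht : 0 < t) :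
    condEntropy P I Y ≤ ENNReal.ofReal (n * ((α - 1) * t)) +
      ENNReal.ofReal (1 / (1 - Real.exp (-t))) * condEntropy P I X := by
  have hp : 0 < 1 - Real.exp (-t) := by simpa using ht
  refine (condEntropy_le_log_add_inv_mul hα hW hI hZ hX hY hM hYX hZX hp
    (by linarith [Real.exp_pos (-t)])).trans ?_
  rw [one_div]
  gcongr
  exact log_one_add_mul_one_sub_exp_neg_le hα ht.le

theorem condEntropy_le_cBound (hα : 1 ≤ α) (hW : ∀ x, W x ≤ ENNReal.ofReal α • Q) (hn : 0 < n)
    (hI : Measurable I) (hZ : Measurable Z) (hX : Measurable X) (hY : Measurable Y)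
    (hM : IsMarkovQuadruple P I Z X Y) (hYX : HasCondLaw P Y X (memoryless W n))
    (hZX : HasCondLaw P Z X (memoryless W n)) (hfin : condEntropy P I X < ∞) :
    condEntropy P I Y < ∞ ∧ (1 / (n : ℝ)) * (condEntropy P I Y).toReal ≤
      cBound α ((1 / (n : ℝ)) * (condEntropy P I X).toReal) := by
  have hbound {t : ℝ} (ht : 0 < t) := condEntropy_le_boundValue hα hW hI hZ hX hY hM hYX hZX ht
  have hmul_ne_top (c : ℝ) : ENNReal.ofReal c * condEntropy P I X ≠ ∞ :=
    ENNReal.mul_ne_top ENNReal.ofReal_ne_top hfin.ne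
  have hY_fin : condEntropy P I Y < ∞ := (hbound one_pos).trans_lt
    (ENNReal.add_lt_top.2 ⟨ENNReal.ofReal_lt_top, (hmul_ne_top _).lt_top⟩)
  refine ⟨hY_fin, le_csInf (nonempty_Ioi.image _) ?_⟩
  rintro _ ⟨t, ht : 0 < t, rfl⟩
  have hp : 0 ≤ 1 / (1 - Real.exp (-t)) := by simpa using ht.le
  have : 0 ≤ α - 1 := sub_nonneg.2 hα
  have : (0 : ℝ) < n := Nat.cast_pos.2 hn
  have hreal : (condEntropy P I Y).toReal ≤
      n * ((α - 1) * t) + 1 / (1 - Real.exp (-t)) * (condEntropy P I X).toReal := by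
    refine (ENNReal.toReal_mono (ENNReal.add_ne_top.2 ⟨ENNReal.ofReal_ne_top, hmul_ne_top _⟩)
      (hbound ht)).trans_eq ?_
    rw [ENNReal.toReal_add ENNReal.ofReal_ne_top (hmul_ne_top _), ENNReal.toReal_mul,
      ENNReal.toReal_ofReal (by positivity), ENNReal.toReal_ofReal hp]
  calc (1 / (n : ℝ)) * (condEntropy P I Y).toReal
      ≤ (1 / (n : ℝ)) *
          (n * ((α - 1) * t) + 1 / (1 - Real.exp (-t)) * (condEntropy P I X).toReal) := by gcongr
    _ = (α - 1) * t + 1 / (1 - Real.exp (-t)) * ((1 / (n : ℝ)) * (condEntropy P I X).toReal) := by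
        field_simp

end MarkovChain

section CBound

variable {α h : ℝ}

lemma boundValues_eq_image : boundValues α h =
    (fun v : ℝ => (α - 1) * Real.log (1 + v) + (1 + v) / v * h) '' Ioi 0 := by
  have hIoi : Ioi (0 : ℝ) = (fun v => Real.log (1 + v)) '' Ioi 0 := by
    ext t
    refine ⟨fun ht => ⟨Real.exp t - 1, by simpa using ht, by simp⟩, ?_⟩
    rintro ⟨v, hv : 0 < v, rfl⟩
    exact Real.log_pos (by linarith)
  refine (congrArg (image _) hIoi).trans ?_
  rw [image_image]
  refine image_congr fun v (hv : 0 < v) => ?_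
  have h1v : 0 < 1 + v := by linarith
  have hfactor : 1 / (1 - Real.exp (-Real.log (1 + v))) = (1 + v) / v := by
    rw [Real.exp_neg, Real.exp_log h1v, ← inv_div v, one_div]
    congr 1
    field_simp
    ring
  rw [hfactor]

lemma cBound_eq_of_forall_ge_of_forall_gt {c : ℝ}
    (hge : ∀ v > 0, c ≤ (α - 1) * Real.log (1 + v) + (1 + v) / v * h)
    (hgt : ∀ b > c, ∃ v > 0, (α - 1) * Real.log (1 + v) + (1 + v) / v * h < b) :
    cBound α h = c := by
  rw [cBound, boundValues_eq_image]
  exact csInf_eq_of_forall_ge_of_forall_gt_exists_lt (nonempty_Ioi.image _)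
    (forall_mem_image.2 hge) fun b hb => exists_mem_image.2 (hgt b hb)

theorem cBound_one (hh : 0 ≤ h) : cBound 1 h = h := by
  refine cBound_eq_of_forall_ge_of_forall_gt (fun v hv => ?_) fun b hb => ?_
  · have : (1 - 1) * Real.log (1 + v) + (1 + v) / v * h = h + h / v := by
      field_simp
      ring
    rw [this]
    exact le_add_of_nonneg_right (by positivity)
  · have hgap : 0 < b - h := sub_pos.2 hb
    refine ⟨(h + 1) / (b - h), by positivity, ?_⟩
    have : (1 - 1) * Real.log (1 + (h + 1) / (b - h)) +
        (1 + (h + 1) / (b - h)) / ((h + 1) / (b - h)) * h = h + (b - h) * (h / (h + 1)) := by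
      field_simp
      ring
    have : (b - h) * (h / (h + 1)) < b - h :=
      mul_lt_of_lt_one_right hgap ((div_lt_one (by positivity)).2 (lt_add_one h))
    linarith

lemma cBound_zero_right (hα : 1 ≤ α) : cBound α 0 = 0 := by
  have : 0 ≤ α - 1 := sub_nonneg.2 hα
  refine cBound_eq_of_forall_ge_of_forall_gt (fun v hv => ?_) fun b hb => ?_
  · have : 0 ≤ Real.log (1 + v) := Real.log_nonneg (by linarith)
    positivity
  · have hv : 0 < b / α := by positivity
    refine ⟨b / α, hv, ?_⟩
    calc (α - 1) * Real.log (1 + b / α) + (1 + b / α) / (b / α) * 0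
        ≤ (α - 1) * (b / α) := by
          rw [mul_zero, add_zero]
          gcongr
          linarith [Real.log_le_sub_one_of_pos (by linarith : 0 < 1 + b / α)]
      _ = b - b / α := by field_simp
      _ < b := sub_lt_self b hv

lemma log_one_add_add_le {v w : ℝ} (hv : 0 < v) (hw : 0 < w) :
    Real.log (1 + w) + w ≤ Real.log (1 + v) + (1 + v) / v * (w ^ 2 / (1 + w)) := by
  have hlog : 1 - (1 + w) / (1 + v) ≤ Real.log (1 + v) - Real.log (1 + w) := by
    rw [← Real.log_div (by positivity) (by positivity), ← inv_div]
    exact Real.one_sub_inv_le_log_of_pos (by positivity)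
  have hsq : 1 - (1 + w) / (1 + v) + (1 + v) / v * (w ^ 2 / (1 + w)) - w =
      (v - w) ^ 2 / ((1 + v) * (v * (1 + w))) := by
    field_simp
    ring
  have : 0 ≤ (v - w) ^ 2 / ((1 + v) * (v * (1 + w))) := by positivity
  linarith

/- Substituting `v = e ^ t - 1`, the hypothesis `hroot` is the first-order condition at `v = w`. -/
lemma isLeast_boundValues {w : ℝ} (hα : 1 < α) (hw : 0 < w)
    (hroot : (α - 1) * w ^ 2 = h * (1 + w)) :
    IsLeast (boundValues α h) ((α - 1) * (Real.log (1 + w) + w)) := by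
  have hh : h = (α - 1) * (w ^ 2 / (1 + w)) := by
    field_simp
    linarith
  rw [boundValues_eq_image, hh]
  refine ⟨⟨w, hw, ?_⟩, forall_mem_image.2 fun v (hv : 0 < v) => ?_⟩
  · field_simp
  · calc (α - 1) * (Real.log (1 + w) + w)
        ≤ (α - 1) * (Real.log (1 + v) + (1 + v) / v * (w ^ 2 / (1 + w))) :=
          mul_le_mul_of_nonneg_left (log_one_add_add_le hv hw) (sub_nonneg.2 hα.le)
      _ = (α - 1) * Real.log (1 + v) + (1 + v) / v * ((α - 1) * (w ^ 2 / (1 + w))) := by ring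

theorem isLeast_boundValues_cClosed (hα : 1 < α) (hh : 0 < h) :
    IsLeast (boundValues α h) (cClosed α h) := by
  have hα0 : 0 < α - 1 := sub_pos.2 hα
  set r := √(h / (α - 1) + h ^ 2 / (4 * (α - 1) ^ 2))
  have hsq : r ^ 2 = h / (α - 1) + h ^ 2 / (4 * (α - 1) ^ 2) := Real.sq_sqrt (by positivity)
  have hroot : (α - 1) * (h / (2 * (α - 1)) + r) ^ 2 = h * (1 + (h / (2 * (α - 1)) + r)) := by
    rw [add_sq, hsq]
    field_simp
    ring
  have hleast := isLeast_boundValues hα (by positivity) hroot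
  rwa [← add_assoc, ← add_assoc] at hleast

theorem cBound_eq_cClosed (hα : 1 < α) (hh : 0 ≤ h) : cBound α h = cClosed α h := by
  rcases hh.eq_or_lt with rfl | hh
  · simp [cBound_zero_right hα.le, cClosed]
  · exact (isLeast_boundValues_cClosed hα hh).csInf_eq

end CBound

section Discrete

variable {𝓧 Ω : Type*} [MeasurableSpace 𝓧] [MeasurableSpace Ω] [Countable Ω]

lemma measure_le_of_singleton_le [MeasurableSingletonClass Ω] {μ ν : Measure Ω}
    (h : ∀ y, μ {y} ≤ ν {y}) : μ ≤ ν := by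
  refine Measure.le_iff.2 fun s hs => ?_
  rw [← Measure.tsum_indicator_apply_singleton μ s hs,
    ← Measure.tsum_indicator_apply_singleton ν s hs]
  exact ENNReal.tsum_le_tsum fun y => indicator_le_indicator (h y)

variable [DiscreteMeasurableSpace Ω] (W : Kernel 𝓧 Ω) [IsMarkovKernel W]

theorem tsum_iSup_lt_top (h : Finite 𝓧 ∨ Finite Ω) : ∑' y : Ω, ⨆ x : 𝓧, W x {y} < ∞ := by
  rcases h with _ | _
  · have := Fintype.ofFinite 𝓧
    calc ∑' y : Ω, ⨆ x : 𝓧, W x {y}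
        ≤ ∑' y : Ω, ∑ x : 𝓧, W x {y} := ENNReal.tsum_le_tsum fun y => iSup_le fun x =>
          Finset.single_le_sum (f := fun x => W x {y}) (fun _ _ => zero_le) (Finset.mem_univ x)
      _ = ∑ x : 𝓧, ∑' y : Ω, W x {y} := Summable.tsum_finsetSum fun _ _ => ENNReal.summable
      _ = Fintype.card 𝓧 := by simp [tsum_measure_singleton]
      _ < ∞ := ENNReal.natCast_lt_top _
  · have := Fintype.ofFinite Ω
    calc ∑' y : Ω, ⨆ x : 𝓧, W x {y}
        ≤ ∑' _ : Ω, 1 := ENNReal.tsum_le_tsum fun y => iSup_le fun x => prob_le_one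
      _ < ∞ := by simp

lemma one_le_tsum_iSup [Nonempty 𝓧] : 1 ≤ ∑' y : Ω, ⨆ x : 𝓧, W x {y} := by
  obtain ⟨x⟩ := ‹Nonempty 𝓧›
  calc (1 : ℝ≥0∞) = ∑' y, W x {y} := by rw [tsum_measure_singleton, measure_univ]
    _ ≤ ∑' y, ⨆ x, W x {y} := ENNReal.tsum_le_tsum fun y => le_iSup (fun x => W x {y}) x

variable {W}

lemma tsum_iSup_le_densityBound {Q : Measure Ω} [IsProbabilityMeasure Q] (h : ∀ x, W x ≪ Q) :
    ∑' y : Ω, ⨆ x : 𝓧, W x {y} ≤ densityBound W Q :=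
  calc ∑' y : Ω, ⨆ x : 𝓧, W x {y}
      ≤ ∑' y, densityBound W Q * Q {y} :=
        ENNReal.tsum_le_tsum fun y => iSup_le fun x => le_densityBound_smul h x {y}
    _ = densityBound W Q := by
        rw [ENNReal.tsum_mul_left, tsum_measure_singleton, measure_univ, mul_one]

/- The optimal `Q` is the normalized maximum likelihood distribution `Q y ∝ ⨆ x, W x {y}`. -/
theorem exists_densityBound_eq_tsum_iSup [Nonempty 𝓧] (h : ∑' y : Ω, ⨆ x : 𝓧, W x {y} < ∞) :
    ∃ Q : Measure Ω, IsProbabilityMeasure Q ∧ (∀ x, W x ≪ Q) ∧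
      densityBound W Q = ∑' y : Ω, ⨆ x : 𝓧, W x {y} := by
  set M := ∑' y : Ω, ⨆ x : 𝓧, W x {y} with hM
  have hM0 : M ≠ 0 := (one_pos.trans_le (one_le_tsum_iSup W)).ne'
  set Q := (PMF.normalize (fun y => ⨆ x, W x {y}) hM0 h.ne).toMeasure with hQ
  have hQ_singleton (y : Ω) : M * Q {y} = ⨆ x, W x {y} := by
    rw [hQ, PMF.toMeasure_apply_singleton _ _ (measurableSet_singleton y), PMF.normalize_apply,
      mul_left_comm, ← hM, ENNReal.mul_inv_cancel hM0 h.ne, mul_one]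
  have hle (x : 𝓧) : W x ≤ M • Q := measure_le_of_singleton_le fun y =>
    (le_iSup (fun x => W x {y}) x).trans_eq (hQ_singleton y).symm
  have hac (x : 𝓧) : W x ≪ Q :=
    (Measure.absolutelyContinuous_of_le (hle x)).trans Measure.smul_absolutelyContinuous
  exact ⟨Q, inferInstance, hac,
    ((densityBound_le_iff hac).2 hle).antisymm (tsum_iSup_le_densityBound hac)⟩

end Discrete

end RelayChannel

theorem mainTheorem5 {𝓧 Ω : Type*} [MeasurableSpace 𝓧] [MeasurableSpace Ω] [Nonempty 𝓧]
    (W : Kernel 𝓧 Ω) [IsMarkovKernel W] :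
    -- the entropy bound
    (∀ (Q : Measure Ω) [IsProbabilityMeasure Q], (∀ x, W x ≪ Q) →
      RelayChannel.densityBound W Q < ∞ →
      1 ≤ (RelayChannel.densityBound W Q).toReal ∧
      ∀ (n : ℕ), 0 < n →
      ∀ {S ι : Type*} [MeasurableSpace S] [MeasurableSpace ι] [Countable ι]
        [DiscreteMeasurableSpace ι] [Nonempty ι] (P : Measure S) [IsProbabilityMeasure P]
        (I : S → ι) (Z : S → Fin n → Ω) (X : S → Fin n → 𝓧) (Y : S → Fin n → Ω),
        Measurable I → Measurable Z → Measurable X → Measurable Y →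
        RelayChannel.IsMarkovQuadruple P I Z X Y →
        RelayChannel.HasCondLaw P Y X (RelayChannel.memoryless W n) →
        RelayChannel.HasCondLaw P Z X (RelayChannel.memoryless W n) →
        RelayChannel.condEntropy P I X < ∞ →
        RelayChannel.condEntropy P I Y < ∞ ∧
        (1 / (n : ℝ)) * (RelayChannel.condEntropy P I Y).toReal ≤
          RelayChannel.cBound (RelayChannel.densityBound W Q).toReal
            ((1 / (n : ℝ)) * (RelayChannel.condEntropy P I X).toReal)) ∧
    -- the minimum and its closed form, with the boundary cases
    (∀ α h : ℝ, 1 < α → 0 ≤ h →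
      (0 < h → IsLeast (RelayChannel.boundValues α h) (RelayChannel.cBound α h)) ∧
      RelayChannel.cBound α h = RelayChannel.cClosed α h) ∧
    (∀ h : ℝ, 0 ≤ h → RelayChannel.cBound 1 h = h) ∧
    -- the discrete case
    (∀ [Countable Ω] [DiscreteMeasurableSpace Ω],
      ((Finite 𝓧 ∨ Finite Ω) → (∑' y : Ω, ⨆ x : 𝓧, W x {y}) < ∞) ∧
      ((∑' y : Ω, ⨆ x : 𝓧, W x {y}) < ∞ →
        ∃ Q : Measure Ω, IsProbabilityMeasure Q ∧ (∀ x, W x ≪ Q) ∧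
          RelayChannel.densityBound W Q = ∑' y : Ω, ⨆ x : 𝓧, W x {y})) := by
  refine ⟨fun Q _ hQ hfin => ?_, fun α h hα hh => ⟨fun hh0 => ?_, ?_⟩, fun h => ?_, ?_⟩
  · have hα : 1 ≤ (RelayChannel.densityBound W Q).toReal := by
      simpa using ENNReal.toReal_mono hfin.ne (RelayChannel.one_le_densityBound hQ)
    have hW (x : 𝓧) : W x ≤ ENNReal.ofReal (RelayChannel.densityBound W Q).toReal • Q := by
      rw [ENNReal.ofReal_toReal hfin.ne]
      exact RelayChannel.le_densityBound_smul hQ x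
    exact ⟨hα, fun n hn S ι _ _ _ _ _ P _ I Z X Y hI hZ hX hY hM hYX hZX =>
      RelayChannel.condEntropy_le_cBound hα hW hn hI hZ hX hY hM hYX hZX⟩
  · rw [RelayChannel.cBound_eq_cClosed hα hh]
    exact RelayChannel.isLeast_boundValues_cClosed hα hh0
  · exact RelayChannel.cBound_eq_cClosed hα hh
  · exact RelayChannel.cBound_one
  · exact ⟨RelayChannel.tsum_iSup_lt_top W, RelayChannel.exists_densityBound_eq_tsum_iSup⟩
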